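/- Let $\mathsf{FI}$ be the category of finite sets and injections. An $\mathsf{FI}$-module is a functor $M\colon \mathsf{FI}\to\mathsf{Ab}$ and an $\mathsf{FI}^{\mathrm{op}}$-module is a functor $N\colon \mathsf{FI}^{\mathrm{op}}\to\mathsf{Ab}$. Write $[n]=\{1,\dots,n\}$, $M_n=M([n])$, $N_n=N([n])$. The tensor product $M\otimes_{\mathsf{FI}}N$ is the quotient of the abelian group $\bigoplus_{n\ge 0} M_n\otimes_{\mathbb Z}N_n$ by the subgroup generated by all elements $M(f)(m)\otimes x-m\otimes N(f)(x)$, where $f\colon[a]\to[b]$ is an injection, $m\in M_a$ and $x\in N_b$. An $\mathsf{FI}^{\mathrm{op}}$-module $N$ is called flat if the functor $M\mapsto M\otimes_{\mathsf{FI}}N$ from $\mathsf{FI}$-modules to abelian groups is exact, i.e. takes short exact sequences to short exact sequences. For $\ell\in\mathbb N=\{0,1,2,\dots\}$ and a finite set $S$, let $X_S=\mathrm{Emb}(S,[\ell]\sqcup\mathbb R)$ be the space of injective maps $S\to[\ell]\sqcup\mathbb R$ (with the topology induced from the product $([\ell]\sqcup\mathbb R)^S$), and let $A_S\subseteq X_S$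 be the subspace of those $\phi$ with $[\ell]\not\subseteq\operatorname{im}\phi$. Let $\Xi(\ell)$ be the $\mathsf{FI}^{\mathrm{op}}$-module $\Xi(\ell)_S=H_0(X_S,A_S;\mathbb Z)$ (relative singular homology), on which injections act by precomposition. **Proposition.** For every $\ell\in\mathbb N$, the $\mathsf{FI}^{\mathrm{op}}$-module $\Xi(\ell)$ is flat; that is, the functor $M\mapsto M\otimes_{\mathsf{FI}}\Xi(\ell)$ is exact. -/

import Mathlib

open CategoryTheory Limits
open scoped TensorProduct DirectSum

universe u

/-! ### The category of finite sets and injections -/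

/-- Objects of the category `FI`: finite sets. -/
structure FI : Type 1 where
  /-- the underlying set -/
  carrier : Type
  /-- the underlying set is finite -/
  finite : Finite carrier

namespace FI

instance : CoeSort FI Type := ⟨FI.carrier⟩

/-- Morphisms of `FI` are injections. -/
instance : Category.{0} FI where
  Hom S T := S.carrier ↪ T.carrier
  id S := Function.Embedding.refl S.carrier
  comp f g := Function.Embedding.trans f g

/-- The finite set `[n]`. These sets form a skeleton of `FI`. -/
def std (n : ℕ) : FI := ⟨Fin n, inferInstance⟩

end FI

/-- `FI`-modules: functors from `FI` to abelian groups. -/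
abbrev FIMod := FI ⥤ AddCommGrpCat.{u}

/-- `FI^op`-modules: functors from `FI^op` to abelian groups. -/
abbrev FIopMod := FIᵒᵖ ⥤ AddCommGrpCat.{0}

noncomputable section

/-! ### The functor tensor product over `FI` -/

namespace FI

/-- The group `⨁ₙ Mₙ ⊗ Nₙ`. -/
abbrev TensorSum (M : FIMod.{u}) (N : FIopMod) : Type u :=
  ⨁ n : ℕ, (M.obj (std n) ⊗[ℤ] N.obj (Opposite.op (std n)))

/-- The element `m ⊗ x` of the `n`-th summand of `⨁ₙ Mₙ ⊗ Nₙ`. -/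
def pureTensor (M : FIMod.{u}) (N : FIopMod) (n : ℕ) (m : M.obj (std n))
    (x : N.obj (Opposite.op (std n))) : TensorSum M N :=
  DirectSum.of (fun n => M.obj (std n) ⊗[ℤ] N.obj (Opposite.op (std n))) n (m ⊗ₜ[ℤ] x)

/-- The subgroup generated by the elements `m f ⊗ x - m ⊗ f x`, where `f : [a] → [b]` is an
injection, `m ∈ M_a` and `x ∈ N_b`. -/
def tensorRel (M : FIMod.{u}) (N : FIopMod) : AddSubgroup (TensorSum M N) :=
  AddSubgroup.closure {z | ∃ (a b : ℕ) (f : std a ⟶ std b) (m : M.obj (std a))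
    (x : N.obj (Opposite.op (std b))),
    z = pureTensor M N b (M.map f m) x - pureTensor M N a m (N.map f.op x)}

/-- The functor tensor product `M ⊗_FI N`. -/
abbrev Tensor (M : FIMod.{u}) (N : FIopMod) : Type u := TensorSum M N ⧸ tensorRel M N

/-- The class of `m ⊗ x` in `M ⊗_FI N`. -/
def tmk (M : FIMod.{u}) (N : FIopMod) (n : ℕ) (m : M.obj (std n))
    (x : N.obj (Opposite.op (std n))) : Tensor M N :=
  QuotientAddGroup.mk' (tensorRel M N) (pureTensor M N n m x)

/-- The map `⨁ₙ Mₙ ⊗ Nₙ → ⨁ₙ M'ₙ ⊗ Nₙ` induced by a map `M → M'`. -/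
def tensorSumMap {M M' : FIMod.{u}} (φ : M ⟶ M') (N : FIopMod) :
    TensorSum M N →+ TensorSum M' N :=
  DirectSum.map fun n =>
    (LinearMap.rTensor (N.obj (Opposite.op (std n)))
      (φ.app (std n)).hom.toIntLinearMap).toAddMonoidHom

theorem tensorSumMap_pureTensor {M M' : FIMod.{u}} (φ : M ⟶ M') (N : FIopMod) (n : ℕ)
    (m : M.obj (std n)) (x : N.obj (Opposite.op (std n))) :
    tensorSumMap φ N (pureTensor M N n m x) = pureTensor M' N n (φ.app (std n) m) x := by
  rw [tensorSumMap, pureTensor, DirectSum.map_of]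
  rfl

theorem tensorSumMap_mem {M M' : FIMod.{u}} (φ : M ⟶ M') (N : FIopMod) :
    tensorRel M N ≤ (tensorRel M' N).comap (tensorSumMap φ N) := by
  refine (AddSubgroup.closure_le _).2 ?_
  rintro _ ⟨a, b, f, m, x, rfl⟩
  refine AddSubgroup.subset_closure ⟨a, b, f, φ.app (std a) m, x, ?_⟩
  rw [map_sub, tensorSumMap_pureTensor, tensorSumMap_pureTensor]
  rw [NatTrans.naturality_apply]

/-- The map `M ⊗_FI N → M' ⊗_FI N` induced by a map `M → M'`. -/
def tensorMap {M M' : FIMod.{u}} (φ : M ⟶ M') (N : FIopMod) :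
    Tensor M N →+ Tensor M' N :=
  QuotientAddGroup.map _ _ (tensorSumMap φ N) (tensorSumMap_mem φ N)

theorem tensorMap_tmk {M M' : FIMod.{u}} (φ : M ⟶ M') (N : FIopMod) (n : ℕ)
    (m : M.obj (std n)) (x : N.obj (Opposite.op (std n))) :
    tensorMap φ N (tmk M N n m x) = tmk M' N n (φ.app (std n) m) x := by
  rw [tmk, tmk, ← tensorSumMap_pureTensor]
  rfl

/-- Homomorphisms out of `M ⊗_FI N` are determined by their values on the classes of `m ⊗ x`. -/
theorem tensor_hom_ext {M : FIMod.{u}} {N : FIopMod} {A : Type*} [AddCommGroup A]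
    {g h : Tensor M N →+ A}
    (H : ∀ n (m : M.obj (std n)) (x : N.obj (Opposite.op (std n))),
      g (tmk M N n m x) = h (tmk M N n m x)) : g = h := by
  refine QuotientAddGroup.addMonoidHom_ext _ (DirectSum.addHom_ext' fun n => ?_)
  ext t
  induction t using TensorProduct.induction_on with
  | zero => rw [map_zero, map_zero]
  | tmul m x => exact H n m x
  | add s t hs ht => rw [map_add, map_add, hs, ht]

/-- The functor `M ↦ M ⊗_FI N` from `FI`-modules to abelian groups. -/
def tensorFunctor (N : FIopMod) : FIMod.{u} ⥤ AddCommGrpCat.{u} where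
  obj M := AddCommGrpCat.of (Tensor M N)
  map φ := AddCommGrpCat.ofHom (tensorMap φ N)
  map_id M := by
    have : tensorMap (𝟙 M) N = AddMonoidHom.id _ := tensor_hom_ext fun n m x => by
      rw [tensorMap_tmk]; rfl
    rw [this]; rfl
  map_comp φ ψ := by
    have : tensorMap (φ ≫ ψ) N = (tensorMap ψ N).comp (tensorMap φ N) :=
      tensor_hom_ext fun n m x => by
        rw [AddMonoidHom.comp_apply, tensorMap_tmk, tensorMap_tmk, tensorMap_tmk]; rfl
    rw [this]; rfl

instance (N : FIopMod) : (tensorFunctor.{u} N).PreservesZeroMorphisms where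
  map_zero M M' := by
    have : tensorMap (0 : M ⟶ M') N = 0 := tensor_hom_ext fun n m x => by
      rw [tensorMap_tmk]
      have h : (0 : M ⟶ M').app (std n) m = 0 := rfl
      rw [h, tmk, pureTensor, TensorProduct.zero_tmul, map_zero, map_zero]; rfl
    change AddCommGrpCat.ofHom (tensorMap (0 : M ⟶ M') N) = 0
    rw [this]; rfl

/-- An `FI^op`-module `N` is flat if the functor `M ↦ M ⊗_FI N` is exact, that is, if it takes
short exact sequences of `FI`-modules to short exact sequences of abelian groups. -/
def IsFlat (N : FIopMod) : Prop :=
  ∀ S : ShortComplex FIMod.{u}, S.ShortExact → (S.map (tensorFunctor.{u} N)).ShortExact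

end FI

/-! ### Relative singular homology -/

/-- The singular chain complex `C(X; ℤ)`. -/
def singularChains : TopCat.{0} ⥤ ChainComplex AddCommGrpCat.{0} ℕ :=
  (AlgebraicTopology.singularChainComplexFunctor AddCommGrpCat.{0}).obj (AddCommGrpCat.of ℤ)

/-- The relative singular chain complex `C(X, A; ℤ) = C(X; ℤ) / C(A; ℤ)` of a continuous map
`A → X` (here a subspace inclusion). -/
def relSingularChains : Arrow TopCat.{0} ⥤ ChainComplex AddCommGrpCat.{0} ℕ where
  obj p := cokernel (singularChains.map p.hom)
  map α := cokernel.map _ _ (singularChains.map α.left) (singularChains.map α.right)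
    (by rw [← Functor.map_comp, ← Functor.map_comp, Arrow.w])
  map_id p := by
    rw [← cancel_epi (cokernel.π _), cokernel.π_desc, Arrow.id_right, CategoryTheory.Functor.map_id]
    simp
  map_comp α β := by
    rw [← cancel_epi (cokernel.π _), cokernel.π_desc, Arrow.comp_right, CategoryTheory.Functor.map_comp]
    simp

/-- The relative singular homology group `H_k(X, A; ℤ)`. -/
def relSingularHomology (k : ℕ) : Arrow TopCat.{0} ⥤ AddCommGrpCat.{0} :=
  relSingularChains ⋙ HomologicalComplex.homologyFunctor _ _ k

/-! ### The `FI^op`-modules `Ξ(ℓ)` -/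

namespace FI

/-- The space `X_S = Emb(S, [ℓ] ⊔ ℝ)`. Since `S` is finite and discrete, an embedding is the same
as an injective map; the topology is induced by the product topology on `([ℓ] ⊔ ℝ)^S`. -/
abbrev EmbSpace (ℓ : ℕ) (S : FI) : Type :=
  {φ : S.carrier → Fin ℓ ⊕ ℝ // Function.Injective φ}

/-- The subset `A_S ⊆ X_S` of embeddings `φ` with `[ℓ] ⊈ im φ`. -/
def missing (ℓ : ℕ) (S : FI) : Set (EmbSpace ℓ S) :=
  {φ | ¬ Set.range (Sum.inl : Fin ℓ → Fin ℓ ⊕ ℝ) ⊆ Set.range φ.1}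

/-- Precomposition `X_T → X_S` with an injection `S → T`. -/
def precomp (ℓ : ℕ) {S T : FI} (g : S.carrier ↪ T.carrier) :
    C(EmbSpace ℓ T, EmbSpace ℓ S) where
  toFun φ := ⟨fun s => φ.1 (g s), φ.2.comp g.injective⟩
  continuous_toFun := by
    refine Continuous.subtype_mk (continuous_pi fun s => ?_) _
    exact (continuous_apply (g s)).comp continuous_subtype_val

theorem precomp_mem (ℓ : ℕ) {S T : FI} (g : S.carrier ↪ T.carrier) (φ : EmbSpace ℓ T)
    (h : φ ∈ missing ℓ T) : precomp ℓ g φ ∈ missing ℓ S := by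
  intro h'
  refine h (h'.trans ?_)
  rintro _ ⟨s, rfl⟩
  exact ⟨g s, rfl⟩

/-- Precomposition `A_T → A_S` with an injection `S → T`. -/
def precompMissing (ℓ : ℕ) {S T : FI} (g : S.carrier ↪ T.carrier) :
    C(missing ℓ T, missing ℓ S) where
  toFun φ := ⟨precomp ℓ g φ.1, precomp_mem ℓ g φ.1 φ.2⟩
  continuous_toFun := by fun_prop

/-- The pair `(X_S, A_S)`, as the inclusion `A_S → X_S`; injections act by precomposition. -/
def embPair (ℓ : ℕ) : FIᵒᵖ ⥤ Arrow TopCat.{0} where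
  obj S := Arrow.mk (TopCat.ofHom
    (⟨Subtype.val, continuous_subtype_val⟩ : C(missing ℓ S.unop, EmbSpace ℓ S.unop)))
  map g := Arrow.homMk (TopCat.ofHom (precompMissing ℓ g.unop)) (TopCat.ofHom (precomp ℓ g.unop)) rfl
  map_id _ := rfl
  map_comp _ _ := rfl

/-- The `FI^op`-module `Ξ(ℓ)`, with `Ξ(ℓ)_S = H_0(X_S, A_S)`. -/
def Xi (ℓ : ℕ) : FIopMod := embPair ℓ ⋙ relSingularHomology 0

end FI

end

/-!
Regard `V = [ℓ] ⊔ ℝ` as a discrete set. The `FI^op`-module `ℤ[Emb(-, V)]` is flat because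
`M ⊗_FI ℤ[Emb(-, V)]` is the filtered colimit of `M(F)` over the finite subsets `F ⊆ V`, and a
retract of a flat module is flat. So it suffices to split the canonical surjection
`ℤ[Emb(S, V)] → H_0(X_S, A_S)` naturally in `S`.

The splitting sends the class of `φ` to `∑_{D ⊆ [ℓ]} (-1)^|D| ∑_a c_n(a) [d_{D, a} ∘ τ]`. Here `τ`
is the order type of `φ`, `n` is the number of points of `φ` on the line, and `d_{D, a}` places the
`k`-th point of the line at the `k`-th term of the sequence `a` and moves the labels in `D` onto the
line, to the left of all terms of `a`. The `c_n` are formal sums of increasing real sequences of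
total coefficient one such that deleting any one of the first `n + 1` terms takes `c_{n+1}` to
`c_n`; they come from a Kan filling argument. This coherence makes the splitting natural, and the
alternating signs make it vanish on embeddings that miss a label. Modulo such embeddings only
`D = ∅` survives, where every term lies in the path component of `φ`.
-/

noncomputable section

namespace FI

open Opposite

/-! ### Flatness criteria -/

section Tensor

variable {M M' M'' : FIMod.{u}} {N P : FIopMod} {A : Type*} [AddCommGroup A]

theorem tmk_map {a b : ℕ} (f : std a ⟶ std b) (m : M.obj (std a)) (x : N.obj (op (std b))) :
    tmk M N b (M.map f m) x = tmk M N a m (N.map f.op x) := by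
  rw [← sub_eq_zero, tmk, tmk, ← map_sub]
  exact (QuotientAddGroup.eq_zero_iff _).2 (AddSubgroup.subset_closure ⟨a, b, f, m, x, rfl⟩)

variable (M N) in
/-- The class `tmk` of `m ⊗ x` as a biadditive map. -/
def tmkHom (n : ℕ) : M.obj (std n) →+ N.obj (op (std n)) →+ Tensor M N :=
  AddMonoidHom.mk' (fun m => AddMonoidHom.mk' (tmk M N n m) fun x y => by
      simp only [tmk, pureTensor, TensorProduct.tmul_add, map_add])
    fun m m' => AddMonoidHom.ext fun x => by
      change tmk M N n (m + m') x = tmk M N n m x + tmk M N n m' x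
      simp only [tmk, pureTensor, TensorProduct.add_tmul, map_add]

@[simp]
theorem tmkHom_apply (n : ℕ) (m : M.obj (std n)) (x : N.obj (op (std n))) :
    tmkHom M N n m x = tmk M N n m x := rfl

/-- A family of biadditive maps `M_n × N_n → A` is balanced if it satisfies the relations that
define `M ⊗_FI N`. -/
def IsBalanced (β : ∀ n, M.obj (std n) →+ N.obj (op (std n)) →+ A) : Prop :=
  ∀ ⦃a b : ℕ⦄ (f : std a ⟶ std b) (m : M.obj (std a)) (x : N.obj (op (std b))),
    β b (M.map f m) x = β a m (N.map f.op x)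

/-- The universal property of `M ⊗_FI N`: a balanced family of biadditive maps
`M_n × N_n → A` induces a homomorphism to `A`. -/
def tensorLift (β : ∀ n, M.obj (std n) →+ N.obj (op (std n)) →+ A)
    (hβ : IsBalanced β) : Tensor M N →+ A :=
  QuotientAddGroup.lift (tensorRel M N)
    (DirectSum.toAddMonoid fun n =>
      TensorProduct.liftAddHom (β n) fun k m x => by simp only [map_zsmul, AddMonoidHom.smul_apply])
    ((AddSubgroup.closure_le _).2 (by
      rintro _ ⟨a, b, f, m, x, rfl⟩
      simp only [SetLike.mem_coe, AddMonoidHom.mem_ker, map_sub, pureTensor,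
        DirectSum.toAddMonoid_of, TensorProduct.liftAddHom_tmul, hβ f m x, sub_self]))

@[simp]
theorem tensorLift_tmk (β : ∀ n, M.obj (std n) →+ N.obj (op (std n)) →+ A)
    (hβ : IsBalanced β) (n : ℕ) (m : M.obj (std n)) (x : N.obj (op (std n))) :
    tensorLift β hβ (tmk M N n m x) = β n m x := by
  refine (QuotientAddGroup.lift_mk' _ _ _).trans ?_
  rw [pureTensor, DirectSum.toAddMonoid_of, TensorProduct.liftAddHom_tmul]

theorem tensorMap_surjective (φ : M ⟶ M') (N : FIopMod)
    (hφ : ∀ n, Function.Surjective (φ.app (std n))) : Function.Surjective (tensorMap φ N) := by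
  have hmk : QuotientAddGroup.mk' (tensorMap φ N).range = 0 := tensor_hom_ext fun n m x => by
    obtain ⟨m, rfl⟩ := hφ n m
    exact (QuotientAddGroup.eq_zero_iff _).2 ⟨tmk M N n m x, tensorMap_tmk φ N n m x⟩
  rw [← AddMonoidHom.range_eq_top, ← QuotientAddGroup.ker_mk' (tensorMap φ N).range, hmk]
  exact AddMonoidHom.ker_zero

/-- The quotient of `M' ⊗ N` by the image of `M ⊗ N` receives a map from `M'' ⊗ N` because the
biadditive map `(m', x) ↦ [m' ⊗ x]` only depends on the image of `m'` in `M''`. -/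
theorem tensorMap_exact (φ : M ⟶ M') (ψ : M' ⟶ M'') (N : FIopMod)
    (hφψ : ∀ n, Function.Exact (φ.app (std n)) (ψ.app (std n)))
    (hψ : ∀ n, Function.Surjective (ψ.app (std n))) :
    Function.Exact (tensorMap φ N) (tensorMap ψ N) := by
  let R := (tensorMap φ N).range
  let β n : M'.obj (std n) →+ N.obj (op (std n)) →+ Tensor M' N ⧸ R :=
    (tmkHom M' N n).compr₂ (QuotientAddGroup.mk' R)
  have hβ n : (ψ.app (std n)).hom.ker ≤ (β n).ker := fun m' hm' => by
    obtain ⟨m, rfl⟩ := (hφψ n m').1 hm'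
    ext x
    exact (QuotientAddGroup.eq_zero_iff _).2 ⟨tmk M N n m x, tensorMap_tmk φ N n m x⟩
  let γ n := (ψ.app (std n)).hom.liftOfSurjective (hψ n) ⟨β n, hβ n⟩
  have hγ n m' : γ n (ψ.app (std n) m') = β n m' :=
    (ψ.app (std n)).hom.liftOfRightInverse_comp_apply _ _ ⟨β n, hβ n⟩ m'
  have hγ_balanced : IsBalanced γ := fun a b f m'' x => by
    obtain ⟨m', rfl⟩ := hψ a m''
    rw [← NatTrans.naturality_apply, hγ, hγ]
    exact congrArg (QuotientAddGroup.mk' R) (tmk_map f m' x)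
  let π := tensorLift γ hγ_balanced
  have hπ : π.comp (tensorMap ψ N) = QuotientAddGroup.mk' R := tensor_hom_ext fun n m' x => by
    rw [AddMonoidHom.comp_apply, tensorMap_tmk]
    exact (tensorLift_tmk γ hγ_balanced n _ x).trans (DFunLike.congr_fun (hγ n m') x)
  have hcomp : (tensorMap ψ N).comp (tensorMap φ N) = 0 := tensor_hom_ext fun n m x => by
    rw [AddMonoidHom.comp_apply, tensorMap_tmk, tensorMap_tmk, (hφψ n).apply_apply_eq_zero,
      ← tmkHom_apply, map_zero]
    rfl
  refine fun y => ⟨fun hy => (QuotientAddGroup.eq_zero_iff (N := R) y).1 ?_, ?_⟩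
  · exact (DFunLike.congr_fun hπ y).symm.trans ((congrArg π hy).trans (map_zero π))
  · rintro ⟨z, rfl⟩
    exact DFunLike.congr_fun hcomp z

theorem isFlat_of_tensorMap_injective (N : FIopMod)
    (h : ∀ {M M' : FIMod.{u}} (φ : M ⟶ M'), (∀ S, Function.Injective (φ.app S)) →
      Function.Injective (tensorMap φ N)) : IsFlat.{u} N := by
  intro S hS
  have hev (T : FI) := hS.map_of_exact ((evaluation FI AddCommGrpCat.{u}).obj T)
  refine ShortComplex.ShortExact.mk' ((ShortComplex.ab_exact_iff_function_exact _).2 ?_)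
    ((AddCommGrpCat.mono_iff_injective _).2 ?_) ((AddCommGrpCat.epi_iff_surjective _).2 ?_)
  · exact tensorMap_exact S.f S.g N
      (fun n => (ShortComplex.ab_exact_iff_function_exact _).1 (hev (std n)).exact)
      fun n => (hev (std n)).ab_surjective_g
  · exact h S.f fun T => (hev T).ab_injective_f
  · exact tensorMap_surjective S.g N fun n => (hev (std n)).ab_surjective_g

theorem IsFlat.tensorMap_injective (hN : IsFlat.{u} N) (φ : M ⟶ M')
    (hφ : ∀ S, Function.Injective (φ.app S)) : Function.Injective (tensorMap φ N) := by
  have : Mono φ := (NatTrans.mono_iff_mono_app φ).2 fun S =>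
    (AddCommGrpCat.mono_iff_injective _).2 (hφ S)
  have hS : (ShortComplex.mk φ (cokernel.π φ) (cokernel.condition φ)).ShortExact :=
    { exact := ShortComplex.exact_cokernel φ }
  exact (hN _ hS).ab_injective_f

variable (M) in
/-- The map `M ⊗_FI N → M ⊗_FI P` induced by a map `N → P`. -/
def tensorMapRight (ν : N ⟶ P) : Tensor M N →+ Tensor M P :=
  tensorLift (fun n => (tmkHom M P n).compl₂ (ν.app (op (std n))).hom) fun _ _ f m x => by
    refine (tmk_map f m _).trans (congrArg (tmk M P _ m) ?_)
    exact (NatTrans.naturality_apply ν f.op x).symm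

theorem tensorMapRight_tmk (ν : N ⟶ P) (n : ℕ) (m : M.obj (std n)) (x : N.obj (op (std n))) :
    tensorMapRight M ν (tmk M N n m x) = tmk M P n m (ν.app (op (std n)) x) :=
  tensorLift_tmk _ _ n m x

theorem tensorMap_tensorMapRight (φ : M ⟶ M') (ν : N ⟶ P) (z : Tensor M N) :
    tensorMap φ P (tensorMapRight M ν z) = tensorMapRight M' ν (tensorMap φ N z) := by
  refine DFunLike.congr_fun (f := (tensorMap φ P).comp (tensorMapRight M ν))
    (g := (tensorMapRight M' ν).comp (tensorMap φ N)) (tensor_hom_ext fun n m x => ?_) z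
  simp only [AddMonoidHom.comp_apply, tensorMap_tmk, tensorMapRight_tmk]

theorem tensorMapRight_injective_of_retract {i : N ⟶ P} {r : P ⟶ N} (hir : i ≫ r = 𝟙 N) :
    Function.Injective (tensorMapRight M i) := by
  have : (tensorMapRight M r).comp (tensorMapRight M i) = AddMonoidHom.id _ :=
    tensor_hom_ext fun n m x => by
      rw [AddMonoidHom.comp_apply, tensorMapRight_tmk, tensorMapRight_tmk,
        ← NatTrans.comp_app_apply, hir]
      rfl
  exact Function.LeftInverse.injective (DFunLike.congr_fun this)

theorem IsFlat.of_retract (hP : IsFlat.{u} P) {i : N ⟶ P} {r : P ⟶ N} (hir : i ≫ r = 𝟙 N) :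
    IsFlat.{u} N := by
  refine isFlat_of_tensorMap_injective N fun {M M'} φ hφ => .of_comp (f := tensorMapRight M' i) ?_
  have : tensorMapRight M' i ∘ tensorMap φ N = tensorMap φ P ∘ tensorMapRight M i :=
    funext fun z => (tensorMap_tensorMapRight φ i z).symm
  rw [this]
  exact (hP.tensorMap_injective φ hφ).comp (tensorMapRight_injective_of_retract hir)

end Tensor

/-! ### Flatness of `ℤ[Emb(-, V)]` -/

theorem directLimitMap_injective {ι : Type*} [Preorder ι] [DecidableEq ι] [Nonempty ι]
    [IsDirectedOrder ι] {G G' : ι → Type*} [∀ i, AddCommGroup (G i)] [∀ i, AddCommGroup (G' i)]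
    {f : ∀ i j, i ≤ j → G i →+ G j} {f' : ∀ i j, i ≤ j → G' i →+ G' j}
    [DirectedSystem G' fun i j h => f' i j h] (g : ∀ i, G i →+ G' i)
    (hg : ∀ i j h, (g j).comp (f i j h) = (f' i j h).comp (g i))
    (hinj : ∀ i, Function.Injective (g i)) :
    Function.Injective (AddCommGroup.DirectLimit.map g hg) := by
  refine (injective_iff_map_eq_zero _).2 fun z hz => ?_
  induction z using AddCommGroup.DirectLimit.induction_on with
  | ih i x =>
    rw [AddCommGroup.DirectLimit.map_apply_of] at hz
    obtain ⟨j, hij, hx⟩ := AddCommGroup.DirectLimit.of.zero_exact i _ hz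
    have hfx : g j (f i j hij x) = g j 0 :=
      (DFunLike.congr_fun (hg i j hij) x).trans (hx.trans (map_zero _).symm)
    rw [← AddCommGroup.DirectLimit.of_f hij, hinj j hfx, map_zero]

instance (S : FI) : Finite S.carrier := S.finite

section TensorObj

variable (M : FIMod.{u}) (N : FIopMod)

/-- A chosen numbering of a finite set. -/
def stdIso (T : FI) : std (Nat.card T.carrier) ≅ T :=
  let e := Finite.equivFin T.carrier
  { hom := e.symm.toEmbedding
    inv := e.toEmbedding
    hom_inv_id := Function.Embedding.ext e.apply_symm_apply
    inv_hom_id := Function.Embedding.ext e.symm_apply_apply }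

/-- The class of `m ⊗ x` in `M ⊗_FI N` for `m ∈ M(T)` and `x ∈ N(T)`, where `T` is any finite set;
it does not depend on the numbering of `T` used in the definition. -/
def tmkObj (T : FI) : M.obj T →+ N.obj (op T) →+ Tensor M N :=
  ((tmkHom M N _).compl₂ (N.map (stdIso T).hom.op).hom).comp (M.map (stdIso T).inv).hom

variable {M N}

theorem tmkObj_map {S T : FI} (f : S ⟶ T) (m : M.obj S) (x : N.obj (op T)) :
    tmkObj M N T (M.map f m) x = tmkObj M N S m (N.map f.op x) := by
  let g := (stdIso S).hom ≫ f ≫ (stdIso T).inv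
  have hm : M.map (stdIso T).inv (M.map f m) = M.map g (M.map (stdIso S).inv m) := by
    simp only [g, ← Functor.map_comp_apply, Iso.inv_hom_id_assoc]
  have hx : N.map g.op (N.map (stdIso T).hom.op x) = N.map (stdIso S).hom.op (N.map f.op x) := by
    simp only [g, ← Functor.map_comp_apply, ← op_comp, Category.assoc, Iso.inv_hom_id,
      Category.comp_id]
  change tmk M N _ (M.map (stdIso T).inv (M.map f m)) _ = tmk M N _ _ (N.map _ (N.map f.op x))
  rw [hm, tmk_map, ← hx]

theorem tmkObj_std (n : ℕ) (m : M.obj (std n)) (x : N.obj (op (std n))) :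
    tmkObj M N (std n) m x = tmk M N n m x := by
  change tmk M N _ (M.map (stdIso (std n)).inv m) (N.map (stdIso (std n)).hom.op x) = _
  rw [tmk_map, ← Functor.map_comp_apply, ← op_comp, Iso.inv_hom_id, op_id, N.map_id]
  rfl

end TensorObj

section FreeEmb

/-- The `FI^op`-module `S ↦ ℤ[Emb(S, V)]` of formal sums of embeddings into a (discrete) set. -/
def freeEmb (V : Type) : FIopMod where
  obj S := AddCommGrpCat.of (FreeAbelianGroup (S.unop.carrier ↪ V))
  map f := AddCommGrpCat.ofHom (FreeAbelianGroup.map fun g => f.unop.trans g)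
  map_id _ := AddCommGrpCat.hom_ext (FreeAbelianGroup.lift_ext _ _ fun _ => rfl)
  map_comp _ _ := AddCommGrpCat.hom_ext (FreeAbelianGroup.lift_ext _ _ fun _ => rfl)

variable {V : Type}

namespace freeEmb

variable {S T : FI} {A : Type*} [AddCommGroup A]

/-- The basis element of `ℤ[Emb(S, V)]` given by an embedding. -/
def of (g : S.carrier ↪ V) : (freeEmb V).obj (op S) :=
  FreeAbelianGroup.of g

theorem map_of (f : S ⟶ T) (g : T.carrier ↪ V) :
    (freeEmb V).map f.op (of g) = of (S := S) (Function.Embedding.trans f g) := rfl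

/-- The linear extension to `ℤ[Emb(S, V)]` of a function on embeddings. -/
def lift (F : (S.carrier ↪ V) → A) : (freeEmb V).obj (op S) →+ A :=
  FreeAbelianGroup.lift F

@[simp]
theorem lift_of (F : (S.carrier ↪ V) → A) (g : S.carrier ↪ V) : lift F (of g) = F g :=
  FreeAbelianGroup.lift_apply_of F g

theorem hom_ext {F G : (freeEmb V).obj (op S) →+ A} (h : ∀ g, F (of g) = G (of g)) : F = G :=
  FreeAbelianGroup.lift_ext F G h

end freeEmb

/-- A finite subset of `V` as an object of `FI`. -/
def ofFinset (F : Finset V) : FI := ⟨F, inferInstance⟩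

/-- The inclusion of finite subsets as a morphism of `FI`. -/
def ofFinsetHom {F G : Finset V} (h : F ≤ G) : ofFinset F ⟶ ofFinset G :=
  Function.Embedding.mk (Set.inclusion h) (Set.inclusion_injective h)

/-- The image of a finite set under an embedding. -/
def embImage {S : FI} (g : S.carrier ↪ V) : Finset V :=
  (Set.finite_range g).toFinset

/-- An embedding, corestricted to its image. -/
def toEmbImage {S : FI} (g : S.carrier ↪ V) : S ⟶ ofFinset (embImage g) :=
  Function.Embedding.codRestrict _ g fun s => (Set.Finite.mem_toFinset _).2 ⟨s, rfl⟩

section FinsetColimit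

variable (M : FIMod.{u})

/-- The homomorphism `M(F) → M(G)` for finite subsets `F ⊆ G` of `V`. -/
abbrev finsetMap (F G : Finset V) (h : F ≤ G) : M.obj (ofFinset F) →+ M.obj (ofFinset G) :=
  (M.map (ofFinsetHom h)).hom

instance : DirectedSystem (fun F : Finset V => M.obj (ofFinset F))
    fun _ _ h => finsetMap M _ _ h where
  map_self F x := DFunLike.congr_fun (congrArg AddCommGrpCat.Hom.hom (M.map_id (ofFinset F))) x
  map_map _ _ _ hFG hGH x := (M.map_comp_apply (ofFinsetHom hFG) (ofFinsetHom hGH) x).symm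

variable [DecidableEq V]

variable (V) in
/-- The colimit of `M(F)` over the finite subsets `F ⊆ V`. -/
abbrev FinsetColimit : Type u :=
  AddCommGroup.DirectLimit (fun F : Finset V => M.obj (ofFinset F)) (finsetMap M)

namespace FinsetColimit

variable {M} {M' : FIMod.{u}}

/-- The image in the colimit of an element of `M(F)`. -/
def of (F : Finset V) : M.obj (ofFinset F) →+ FinsetColimit V M :=
  AddCommGroup.DirectLimit.of _ (finsetMap M) F

theorem of_map_eq {S : FI} {F : Finset V} (j : S ⟶ ofFinset F) (g : S.carrier ↪ V)
    (hj : ∀ s, Subtype.val (j.toFun s) = g s) (m : M.obj S) :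
    of F (M.map j m) = of (embImage g) (M.map (toEmbImage g) m) := by
  have hF : embImage g ≤ F := fun v hv => by
    obtain ⟨s, rfl⟩ := (Set.Finite.mem_toFinset _).1 hv
    exact hj s ▸ (j.toFun s).2
  have : j = toEmbImage g ≫ ofFinsetHom hF :=
    Function.Embedding.ext fun s => Subtype.ext (hj s)
  rw [this, M.map_comp_apply]
  exact AddCommGroup.DirectLimit.of_f (f := finsetMap M) hF _

/-- The biadditive map sending `(m, g)` to the class of `M(g)(m)`, where `g` is regarded as a
bijection from `S` onto the finite set `F = im g`. -/
def evalHom (S : FI) : M.obj S →+ (freeEmb V).obj (op S) →+ FinsetColimit V M :=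
  (freeEmb.lift fun g => (of (embImage g)).comp (M.map (toEmbImage g)).hom).flip

theorem evalHom_of {S : FI} (m : M.obj S) (g : S.carrier ↪ V) :
    evalHom S m (freeEmb.of g) = of (embImage g) (M.map (toEmbImage g) m) :=
  DFunLike.congr_fun (freeEmb.lift_of (fun g : S.carrier ↪ V =>
    (of (embImage g)).comp (M.map (toEmbImage g)).hom) g) m

theorem evalHom_map {S T : FI} (f : S ⟶ T) (m : M.obj S) (x : (freeEmb V).obj (op T)) :
    evalHom T (M.map f m) x = evalHom S m ((freeEmb V).map f.op x) := by
  have : evalHom T (M.map f m) = (evalHom S m).comp ((freeEmb V).map f.op).hom :=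
    freeEmb.hom_ext fun g => by
      refine (evalHom_of _ g).trans (Eq.trans ?_ (evalHom_of m _).symm)
      rw [← M.map_comp_apply]
      exact of_map_eq (f ≫ toEmbImage g) _ (fun _ => rfl) m
  exact DFunLike.congr_fun this x

variable (V M) in
/-- The map `M ⊗_FI ℤ[Emb(-, V)] → colim_F M(F)` induced by `evalHom`. -/
def ofTensor : Tensor M (freeEmb V) →+ FinsetColimit V M :=
  tensorLift (fun n => evalHom (std n)) fun _ _ => evalHom_map

theorem ofTensor_tmk (n : ℕ) (m : M.obj (std n)) (x : (freeEmb V).obj (op (std n))) :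
    ofTensor V M (tmk M (freeEmb V) n m x) = evalHom (std n) m x :=
  tensorLift_tmk _ _ n m x

/-- The element of `ℤ[Emb(F, V)]` given by the inclusion of a finite subset. -/
def inclusion (F : Finset V) : (freeEmb V).obj (op (ofFinset F)) :=
  freeEmb.of (S := ofFinset F) (Function.Embedding.subtype (· ∈ F))

variable (V M) in
/-- A left inverse of `ofTensor`, which sends the class of `m ∈ M(F)` to `m ⊗ (F ↪ V)`. -/
def toTensor : FinsetColimit V M →+ Tensor M (freeEmb V) :=
  AddCommGroup.DirectLimit.lift _ (finsetMap M) _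
    (fun F => (tmkObj M (freeEmb V) (ofFinset F)).flip (inclusion F))
    fun _ _ h m => tmkObj_map (ofFinsetHom h) m _

theorem toTensor_of (F : Finset V) (m : M.obj (ofFinset F)) :
    toTensor V M (of F m) = tmkObj M (freeEmb V) (ofFinset F) m (inclusion F) :=
  AddCommGroup.DirectLimit.lift_of (f := finsetMap M) _ _ _ F m

theorem toTensor_ofTensor (z : Tensor M (freeEmb V)) : toTensor V M (ofTensor V M z) = z := by
  have key (n : ℕ) (m : M.obj (std n)) :
      (toTensor V M).comp (evalHom (std n) m) = tmkHom M (freeEmb V) n m :=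
    freeEmb.hom_ext fun g => by
      rw [AddMonoidHom.comp_apply, evalHom_of, toTensor_of, tmkObj_map, tmkHom_apply, ← tmkObj_std]
      rfl
  have : (toTensor V M).comp (ofTensor V M) = AddMonoidHom.id _ := tensor_hom_ext fun n m x => by
    rw [AddMonoidHom.comp_apply, ofTensor_tmk]
    exact DFunLike.congr_fun (key n m) x
  exact DFunLike.congr_fun this z

/-- The map of colimits induced by a map of `FI`-modules. -/
def map (φ : M ⟶ M') : FinsetColimit V M →+ FinsetColimit V M' :=
  AddCommGroup.DirectLimit.map (f := finsetMap M) (f' := finsetMap M')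
    (fun F => (φ.app (ofFinset F)).hom) fun _ _ h =>
    congrArg AddCommGrpCat.Hom.hom (φ.naturality (ofFinsetHom h))

theorem map_of (φ : M ⟶ M') (F : Finset V) (m : M.obj (ofFinset F)) :
    map φ (of F m) = of F (φ.app (ofFinset F) m) :=
  AddCommGroup.DirectLimit.map_apply_of (f := finsetMap M) (f' := finsetMap M') _ _ m

theorem map_injective (φ : M ⟶ M') (hφ : ∀ S, Function.Injective (φ.app S)) :
    Function.Injective (map (V := V) φ) :=
  directLimitMap_injective _ _ fun F => hφ (ofFinset F)

theorem map_ofTensor (φ : M ⟶ M') (z : Tensor M (freeEmb V)) :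
    map φ (ofTensor V M z) = ofTensor V M' (tensorMap φ (freeEmb V) z) := by
  have key (n : ℕ) (m : M.obj (std n)) :
      (map φ).comp (evalHom (V := V) (std n) m) = evalHom (std n) (φ.app (std n) m) :=
    freeEmb.hom_ext fun g => by
      rw [AddMonoidHom.comp_apply, evalHom_of, evalHom_of, map_of, NatTrans.naturality_apply]
  have : (map φ).comp (ofTensor V M) = (ofTensor V M').comp (tensorMap φ (freeEmb V)) :=
    tensor_hom_ext fun n m x => by
      rw [AddMonoidHom.comp_apply, AddMonoidHom.comp_apply, tensorMap_tmk, ofTensor_tmk,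
        ofTensor_tmk, ← key]
      rfl
  exact DFunLike.congr_fun this z

end FinsetColimit

end FinsetColimit

theorem isFlat_freeEmb (V : Type) : IsFlat.{u} (freeEmb V) := by
  classical
  refine isFlat_of_tensorMap_injective _ fun {M M'} φ hφ =>
    .of_comp (f := FinsetColimit.ofTensor V M') ?_
  have : FinsetColimit.ofTensor V M' ∘ tensorMap φ (freeEmb V) =
      FinsetColimit.map φ ∘ FinsetColimit.ofTensor V M :=
    funext fun z => (FinsetColimit.map_ofTensor φ z).symm
  rw [this]
  exact (FinsetColimit.map_injective φ hφ).comp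
    (Function.LeftInverse.injective FinsetColimit.toTensor_ofTensor)

end FreeEmb

/-! ### A coherent family of formal sums of increasing sequences -/

section IncreasingSequences

/-- The increasing map `ℕ → ℕ` that omits the value `i`. -/
def skip (i : ℕ) : ℕ ↪o ℕ :=
  OrderEmbedding.ofStrictMono (fun k => if k < i then k else k + 1) fun k l h => by grind

theorem skip_apply (i k : ℕ) : skip i k = if k < i then k else k + 1 := rfl

theorem skip_trans_skip {i j : ℕ} (h : i ≤ j) :
    (skip i).trans (skip (j + 1)) = (skip j).trans (skip i) := by
  ext k
  simp only [RelEmbedding.coe_trans, Function.comp_apply, skip_apply]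
  grind

variable {α : Type*}

/-- The sequence obtained from `a` by inserting `p (a j)` before the `j`-th term. -/
def insertTerm (p : α → α) (j : ℕ) (a : ℕ → α) (k : ℕ) : α :=
  if k < j then a k else if k = j then p (a j) else a (k - 1)

theorem insertTerm_skip_self (p : α → α) (j : ℕ) (a : ℕ → α) (k : ℕ) :
    insertTerm p j a (skip j k) = a k := by
  grind [insertTerm, skip_apply]

theorem insertTerm_skip {i j : ℕ} (h : i ≤ j) (p : α → α) (a : ℕ → α) (k : ℕ) :
    insertTerm p (j + 1) a (skip i k) = insertTerm p j (fun l => a (skip i l)) k := by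
  grind [insertTerm, skip_apply]

section Preorder

variable [Preorder α]

theorem strictMono_insertTerm {p : α → α} {j : ℕ} {a : ℕ → α} (ha : StrictMono a)
    (hp : p (a j) < a j) (hp' : ∀ i < j, a i < p (a j)) : StrictMono (insertTerm p j a) := by
  refine strictMono_nat_of_lt_succ fun k => ?_
  have hsucc : a k < a (k + 1) := ha k.lt_succ_self
  rcases lt_trichotomy k j with hk | rfl | hk
  · grind [insertTerm]
  · simpa [insertTerm] using hp
  · have hpred : a (k - 1) < a k := ha (by lia)
    grind [insertTerm]

open Classical in
/-- `insertTerm` as an operation on increasing sequences, with the junk value `a` when the inserted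
term breaks the order. -/
def insertEmb (p : α → α) (j : ℕ) (a : ℕ ↪o α) : ℕ ↪o α :=
  if h : StrictMono (insertTerm p j a) then ⟨⟨_, h.injective⟩, h.le_iff_le⟩ else a

theorem insertEmb_apply {p : α → α} {j : ℕ} {a : ℕ ↪o α} (h : StrictMono (insertTerm p j a))
    (k : ℕ) : insertEmb p j a k = insertTerm p j a k := by
  rw [insertEmb, dif_pos h]
  rfl

theorem skip_trans_insertEmb_self {p : α → α} {j : ℕ} {a : ℕ ↪o α}
    (h : StrictMono (insertTerm p j a)) : (skip j).trans (insertEmb p j a) = a := by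
  ext k
  exact (insertEmb_apply h _).trans (insertTerm_skip_self p j a k)

theorem skip_trans_insertEmb {i j : ℕ} (hij : i ≤ j) {p : α → α} {a : ℕ ↪o α}
    (h : StrictMono (insertTerm p (j + 1) a)) :
    (skip i).trans (insertEmb p (j + 1) a) = insertEmb p j ((skip i).trans a) := by
  have h' : StrictMono (insertTerm p j ((skip i).trans a)) := by
    convert h.comp (skip i).strictMono using 1
    exact funext fun k => (insertTerm_skip hij p a k).symm
  ext k
  exact (insertEmb_apply h _).trans ((insertTerm_skip hij p a k).trans (insertEmb_apply h' k).symm)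

/-- Integral formal sums of increasing sequences. -/
abbrev SeqSum (α : Type*) [Preorder α] : Type _ := (ℕ ↪o α) →₀ ℤ

/-- Restriction of sequences to the subsequence picked out by `σ`, extended linearly. -/
def pull (σ : ℕ ↪o ℕ) : SeqSum α →ₗ[ℤ] SeqSum α :=
  Finsupp.lmapDomain ℤ ℤ fun a => σ.trans a

/-- The simplicial face operator that deletes the `i`-th term of a sequence. -/
abbrev face (i : ℕ) : SeqSum α →ₗ[ℤ] SeqSum α := pull (skip i)

/-- The sum of the coefficients. -/
def mass : SeqSum α →ₗ[ℤ] ℤ := Finsupp.linearCombination ℤ fun _ => 1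

theorem pull_pull (σ τ : ℕ ↪o ℕ) (z : SeqSum α) : pull σ (pull τ z) = pull (σ.trans τ) z :=
  Finsupp.mapDomain_comp.symm

theorem face_face {i j : ℕ} (h : i ≤ j) (z : SeqSum α) :
    face i (face (j + 1) z) = face j (face i z) := by
  rw [pull_pull, pull_pull, skip_trans_skip h]

theorem linearCombination_pull {G : Type*} [AddCommGroup G] (v : (ℕ ↪o α) → G) (σ : ℕ ↪o ℕ)
    (z : SeqSum α) :
    Finsupp.linearCombination ℤ v (pull σ z) =
      Finsupp.linearCombination ℤ (fun a => v (σ.trans a)) z :=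
  Finsupp.linearCombination_mapDomain ℤ _ z

theorem mass_pull (σ : ℕ ↪o ℕ) (z : SeqSum α) : mass (pull σ z) = mass z :=
  linearCombination_pull _ σ z

theorem linearCombination_const {G : Type*} [AddCommGroup G] (g : G) (z : SeqSum α) :
    Finsupp.linearCombination ℤ (fun _ => g) z = mass z • g := by
  simp only [mass, Finsupp.linearCombination_apply, Finsupp.sum, Finset.sum_smul, smul_assoc,
    one_smul]

/-- A sequence of formal sums of increasing sequences of total coefficient one, such that every
face of the `n + 1`-st that deletes one of the first `n + 1` terms is the `n`-th. Only the first
`n` terms of the sequences in the `n`-th sum matter. -/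
structure IsCoherent (c : ℕ → SeqSum α) : Prop where
  face_eq (n i : ℕ) (h : i ≤ n) : face i (c (n + 1)) = c n
  mass_eq (n : ℕ) : mass (c n) = 1

end Preorder

section Filling

variable [LinearOrder α] [DenselyOrdered α] [NoMinOrder α] [NoMaxOrder α] [Nonempty α]

theorem exists_between_predecessors (B : Finset α) :
    ∃ p : α → α, ∀ x, p x < x ∧ ∀ b ∈ B, b < x → b < p x := by
  choose p hp using fun x => Order.exists_between_finsets (B.filter (· < x)) {x} (by simp)
  exact ⟨p, fun x => by grind⟩

theorem exists_degeneracy (j : ℕ) (w : SeqSum α) :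
    ∃ z, face j z = w ∧ ((∀ i < j, face i w = 0) → ∀ i < j, face i z = 0) := by
  obtain ⟨p, hp⟩ :=
    exists_between_predecessors (w.support.biUnion fun a => (Finset.range j).image a)
  have hmono (a) (ha : a ∈ w.support) : StrictMono (insertTerm p j a) :=
    strictMono_insertTerm a.strictMono (hp _).1 fun i hi => (hp _).2 _
      (Finset.mem_biUnion.2 ⟨a, ha, Finset.mem_image_of_mem _ (Finset.mem_range.2 hi)⟩)
      (a.strictMono hi)
  refine ⟨w.mapDomain (insertEmb p j), ?_, fun hw i hi => ?_⟩
  · refine (Finsupp.mapDomain_comp.symm.trans (Finsupp.mapDomain_congr fun a ha => ?_)).trans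
      Finsupp.mapDomain_id
    exact skip_trans_insertEmb_self (hmono a ha)
  · obtain ⟨j, rfl⟩ := Nat.exists_eq_succ_of_ne_zero (Nat.ne_zero_of_lt hi)
    calc face i (w.mapDomain (insertEmb p (j + 1)))
        = w.mapDomain fun a => insertEmb p j ((skip i).trans a) :=
          Finsupp.mapDomain_comp.symm.trans (Finsupp.mapDomain_congr fun a ha =>
            skip_trans_insertEmb (Nat.le_of_lt_succ hi) (hmono a ha))
      _ = (face i w).mapDomain (insertEmb p j) :=
          Finsupp.mapDomain_comp (v := w) (f := fun a => (skip i).trans a) (g := insertEmb p j)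
      _ = 0 := by rw [hw i hi, Finsupp.mapDomain_zero]

/-- The Kan filling argument for simplicial abelian groups: the faces are corrected one after the
other, each correction leaving the previous faces unchanged. -/
theorem exists_filling {n : ℕ} {c : SeqSum α}
    (hc : ∀ i < n, ∀ i' < n, face i c = face i' c) : ∃ z, ∀ i ≤ n, face i z = c := by
  suffices ∀ j ≤ n + 1, ∃ z, ∀ i < j, face i z = c by
    simpa only [Nat.lt_succ_iff] using this (n + 1) le_rfl
  intro j hj
  induction j with
  | zero => exact ⟨0, fun i hi => absurd hi i.not_lt_zero⟩
  | succ j ih =>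
    obtain ⟨z, hz⟩ := ih (by lia)
    obtain ⟨y, hy, hy'⟩ := exists_degeneracy j (c - face j z)
    have hface (i) (hi : i < j) : face i (c - face j z) = 0 := by
      obtain ⟨j, rfl⟩ := Nat.exists_eq_succ_of_ne_zero (Nat.ne_zero_of_lt hi)
      rw [map_sub, face_face (Nat.le_of_lt_succ hi), hz i hi, sub_eq_zero]
      exact hc i (by lia) j (by lia)
    refine ⟨z + y, fun i hi => ?_⟩
    rcases Nat.lt_succ_iff_lt_or_eq.1 hi with hi | rfl
    · rw [map_add, hz i hi, hy' hface i hi, add_zero]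
    · rw [map_add, hy, add_sub_cancel]

variable (α) in
theorem exists_isCoherent : ∃ c : ℕ → SeqSum α, IsCoherent c := by
  choose! fill hfill using fun (n : ℕ) (c : SeqSum α) => exists_filling (n := n) (c := c)
  obtain ⟨a, ha⟩ := Nat.exists_strictMono α
  let c (n : ℕ) : SeqSum α :=
    n.rec (Finsupp.single (OrderEmbedding.ofStrictMono a ha) 1) fun n c => fill n c
  have hface (n) : ∀ i ≤ n, face i (c (n + 1)) = c n := by
    induction n with
    | zero => exact hfill 0 (c 0) fun i hi => absurd hi i.not_lt_zero
    | succ n ih =>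
      exact hfill (n + 1) (c (n + 1)) fun i hi i' hi' =>
        (ih i (Nat.le_of_lt_succ hi)).trans (ih i' (Nat.le_of_lt_succ hi')).symm
  refine ⟨c, hface, fun n => ?_⟩
  induction n with
  | zero => simp [c, mass]
  | succ n ih => rw [← mass_pull (skip 0), hface n 0 n.zero_le, ih]

end Filling

section Rank

variable [LinearOrder α]

/-- The number of elements of `A` below `x`. -/
def rank (A : Finset α) (x : α) : ℕ := (A.filter (· < x)).card

theorem rank_lt_rank {A : Finset α} {x y : α} (hx : x ∈ A) (h : x < y) : rank A x < rank A y :=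
  Finset.card_lt_card <| Finset.ssubset_iff_of_subset
    (Finset.monotone_filter_right A fun _ _ hz => lt_trans hz h) |>.2 ⟨x, by simp [hx, h], by simp⟩

theorem rank_le_card (A : Finset α) (x : α) : rank A x ≤ A.card := Finset.card_filter_le _ _

theorem rank_insert {A : Finset α} {x r : α} (hx : x ∉ A) (hr : r ∈ A) :
    rank (insert x A) r = skip (rank A x) (rank A r) := by
  rw [skip_apply, rank, Finset.filter_insert]
  rcases lt_or_gt_of_ne (ne_of_mem_of_not_mem hr hx) with h | h
  · rw [if_neg h.not_gt, if_pos (rank_lt_rank hr h), rank]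
  · have hle : rank A x ≤ rank A r :=
      Finset.card_le_card (Finset.monotone_filter_right A fun _ _ hz => lt_trans hz h)
    rw [if_pos h, if_neg hle.not_gt, Finset.card_insert_of_notMem (by simp [hx]), rank]

theorem IsCoherent.exists_pull {β : Type*} [Preorder β] {c : ℕ → SeqSum β} (hc : IsCoherent c)
    {A B : Finset α} (h : B ⊆ A) :
    ∃ σ : ℕ ↪o ℕ, (∀ r ∈ B, σ (rank B r) = rank A r) ∧ pull σ (c A.card) = c B.card := by
  rw [← Finset.sdiff_union_of_subset h]
  induction A \ B using Finset.induction_on with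
  | empty =>
    rw [Finset.empty_union]
    exact ⟨RelEmbedding.refl _, fun _ _ => rfl, Finsupp.mapDomain_id⟩
  | insert x D _ ih =>
    obtain ⟨σ, hσ, hpull⟩ := ih
    rw [Finset.insert_union]
    by_cases hx : x ∈ D ∪ B
    · exact ⟨σ, by rwa [Finset.insert_eq_of_mem hx], by rwa [Finset.insert_eq_of_mem hx]⟩
    · refine ⟨σ.trans (skip (rank (D ∪ B) x)), fun r hr => ?_, ?_⟩
      · rw [rank_insert hx (Finset.mem_union_right D hr), ← hσ r hr]
        rfl
      · rw [Finset.card_insert_of_notMem hx, ← pull_pull, hc.face_eq _ _ (rank_le_card _ _), hpull]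

end Rank

end IncreasingSequences

/-! ### Order types of embeddings into a set of labels and a line -/

section OrderType

variable {S ι α β : Type*}

theorem exists_eq_map_comp {φ : S ↪ ι ⊕ α} {ψ : S → ι ⊕ α}
    (h : ∀ s, ∃ f : α → α, ψ s = Sum.map id f (φ s)) : ∃ f : α → α, ψ = Sum.map id f ∘ φ := by
  choose f hf using h
  refine ⟨fun x => Function.extend φ f (fun _ => id) (Sum.inr x) x, funext fun s => ?_⟩
  rw [hf, Function.comp_apply]
  rcases hs : φ s with i | x
  · rfl
  · rw [Sum.map_inr, Sum.map_inr, ← hs, φ.injective.extend_apply]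

theorem eventually_eq_map [TopologicalSpace ι] [DiscreteTopology ι] [TopologicalSpace α]
    (v : ι ⊕ α) : ∀ᶠ w in nhds v, ∃ f : α → α, w = Sum.map id f v := by
  rcases v with i | x
  · rw [nhds_inl, nhds_discrete]
    exact ⟨id, rfl⟩
  · simpa [nhds_inr] using .of_forall fun y => ⟨fun _ => y, rfl⟩

variable [Finite S]

/-- The finite set of points of the line `α` hit by a map to `ι ⊔ α`. -/
def lineImage (φ : S → ι ⊕ α) : Finset α :=
  ((Set.finite_range φ).preimage Sum.inr_injective.injOn).toFinset

theorem mem_lineImage {φ : S → ι ⊕ α} {x : α} : x ∈ lineImage φ ↔ ∃ s, φ s = Sum.inr x := by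
  simp [lineImage]

theorem lineImage_map [DecidableEq β] (φ : S → ι ⊕ α) (h : α → β) :
    lineImage (Sum.map id h ∘ φ) = (lineImage φ).image h := by
  ext y
  simp only [mem_lineImage, Finset.mem_image, Function.comp_apply]
  constructor
  · rintro ⟨s, hs⟩
    rcases hφ : φ s with i | x <;> simp only [hφ, Sum.map_inl, Sum.map_inr, reduceCtorEq] at hs
    exact ⟨x, ⟨s, hφ⟩, Sum.inr_injective hs⟩
  · rintro ⟨x, ⟨s, hs⟩, rfl⟩
    exact ⟨s, by rw [hs, Sum.map_inr]⟩

theorem lineImage_trans_subset {S' : Type*} [Finite S'] (f : S' ↪ S) (φ : S ↪ ι ⊕ α) :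
    lineImage (f.trans φ) ⊆ lineImage φ := fun x hx => by
  obtain ⟨s, hs⟩ := mem_lineImage.1 hx
  exact mem_lineImage.2 ⟨f s, hs⟩

theorem injective_map_comp {φ : S → ι ⊕ α} (hφ : Function.Injective φ) {h : α → β}
    (hh : Set.InjOn h (lineImage φ)) : Function.Injective (Sum.map id h ∘ φ) := fun s t hst => by
  apply hφ
  have hmem (s x) (hs : φ s = Sum.inr x) : x ∈ lineImage φ := mem_lineImage.2 ⟨s, hs⟩
  rcases hs : φ s with i | x <;> rcases ht : φ t with j | y <;>
    simp only [Function.comp_apply, hs, ht, Sum.map_inl, Sum.map_inr, id_eq, Sum.inl.injEq,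
      Sum.inr.injEq, reduceCtorEq] at hst ⊢
  · exact hst
  · exact hh (hmem s x hs) (hmem t y ht) hst

variable [LinearOrder α] [LinearOrder β]

theorem rank_injOn (A : Finset α) : Set.InjOn (rank A) A :=
  StrictMonoOn.injOn fun _ hx _ _ => rank_lt_rank hx

theorem rank_image {A : Finset α} {h : α → β} (hh : StrictMonoOn h A) {x : α} (hx : x ∈ A) :
    rank (A.image h) (h x) = rank A x := by
  rw [rank, rank, Finset.filter_image, Finset.card_image_of_injOn]
  · exact congrArg Finset.card (Finset.filter_congr fun y hy => hh.lt_iff_lt hy hx)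
  · exact hh.injOn.mono (Finset.filter_subset _ _)

/-- The embedding obtained by replacing the points on the line by their positions `0, 1, 2, …`. -/
def orderType (φ : S ↪ ι ⊕ α) : S ↪ ι ⊕ ℕ :=
  ⟨Sum.map id (rank (lineImage φ)) ∘ φ, injective_map_comp φ.injective (rank_injOn _)⟩

theorem orderType_eq {φ : S ↪ ι ⊕ α} {ψ : S ↪ ι ⊕ β} {h : α → β} (hh : StrictMonoOn h (lineImage φ))
    (hψ : ψ = Sum.map id h ∘ φ) : orderType ψ = orderType φ := by
  ext s : 1
  change Sum.map id (rank (lineImage ψ)) (ψ s) = Sum.map id (rank (lineImage φ)) (φ s)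
  rw [hψ, lineImage_map, Function.comp_apply]
  rcases hs : φ s with i | x
  · rfl
  · exact congrArg Sum.inr (rank_image hh (mem_lineImage.2 ⟨s, hs⟩))

theorem orderType_eq_inl_iff {φ : S ↪ ι ⊕ α} {s : S} {i : ι} :
    orderType φ s = Sum.inl i ↔ φ s = Sum.inl i := by
  rcases hs : φ s <;> simp [orderType, hs]

theorem card_lineImage_orderType (φ : S ↪ ι ⊕ α) :
    (lineImage (orderType φ)).card = (lineImage φ).card := by
  rw [orderType, Function.Embedding.coeFn_mk, lineImage_map,
    Finset.card_image_of_injOn (rank_injOn _)]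

theorem orderType_trans {S' : Type*} [Finite S'] (f : S' ↪ S) (φ : S ↪ ι ⊕ α) {σ : ℕ → ℕ}
    (hσ : ∀ x ∈ lineImage (f.trans φ),
      σ (rank (lineImage (f.trans φ)) x) = rank (lineImage φ) x) (s : S') :
    orderType φ (f s) = Sum.map id σ (orderType (f.trans φ) s) := by
  change Sum.map id _ (φ (f s)) = Sum.map id σ (Sum.map id _ (φ (f s)))
  rcases hs : φ (f s) with i | x
  · rfl
  · exact congrArg Sum.inr (hσ x (mem_lineImage.2 ⟨s, hs⟩)).symm

theorem eventually_exists_strictMonoOn [TopologicalSpace ι] [DiscreteTopology ι]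
    [TopologicalSpace α] [OrderClosedTopology α] (φ : S ↪ ι ⊕ α) :
    ∀ᶠ ψ in nhds (φ : S → ι ⊕ α), ∃ h, StrictMonoOn h (lineImage φ) ∧ ψ = Sum.map id h ∘ φ := by
  have hmap : ∀ᶠ ψ in nhds (φ : S → ι ⊕ α), ∀ s, ∃ f : α → α, ψ s = Sum.map id f (φ s) :=
    Filter.eventually_all.2 fun s => (continuous_apply s).continuousAt (eventually_eq_map (φ s))
  have hlt : ∀ᶠ ψ in nhds (φ : S → ι ⊕ α), ∀ x ∈ lineImage φ, ∀ y ∈ lineImage φ, x < y →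
      ∀ s t, φ s = Sum.inr x → φ t = Sum.inr y →
        Sum.elim (fun _ => x) id (ψ s) < Sum.elim (fun _ => x) id (ψ t) := by
    refine (Filter.eventually_all_finset _).2 fun x _ =>
      (Filter.eventually_all_finset _).2 fun y _ => ?_
    simp only [Filter.eventually_imp_distrib_left, Filter.eventually_all]
    intro hxy s t hs ht
    have hcont (s) : ContinuousAt (fun ψ : S → ι ⊕ α => Sum.elim (fun _ => x) id (ψ s)) φ :=
      ((continuous_const.sumElim continuous_id).comp (continuous_apply s)).continuousAt
    exact (hcont s).eventually_lt (hcont t) (by simpa [hs, ht] using hxy)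
  filter_upwards [hmap, hlt] with ψ hmap hlt
  obtain ⟨h, rfl⟩ := exists_eq_map_comp hmap
  refine ⟨h, fun x hx y hy hxy => ?_, rfl⟩
  obtain ⟨s, hs⟩ := mem_lineImage.1 hx
  obtain ⟨t, ht⟩ := mem_lineImage.1 hy
  simpa [hs, ht] using hlt x hx y hy hxy s t hs ht

end OrderType

section EmbSpace

variable {ℓ : ℕ} {S : FI}

/-- A point of `Emb(S, [ℓ] ⊔ ℝ)` as a bundled embedding. -/
abbrev EmbSpace.toEmb (φ : EmbSpace ℓ S) : S.carrier ↪ Fin ℓ ⊕ ℝ := ⟨φ.1, φ.2⟩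

theorem isLocallyConstant_orderType :
    IsLocallyConstant fun φ : EmbSpace ℓ S => orderType φ.toEmb := by
  refine (IsLocallyConstant.iff_eventually_eq _).2 fun φ => ?_
  filter_upwards [continuous_subtype_val.continuousAt (eventually_exists_strictMonoOn φ.toEmb)] with
    ψ ⟨h, hh, hψ⟩
  exact orderType_eq hh hψ

theorem orderType_eq_of_joined {φ ψ : EmbSpace ℓ S} (h : Joined φ ψ) :
    orderType φ.toEmb = orderType ψ.toEmb := by
  obtain ⟨γ⟩ := h
  have hγ := isLocallyConstant_orderType.comp_continuous γ.continuous
  simpa using hγ.apply_eq_of_preconnectedSpace 0 1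

/-- The straight line path from `φ` to `ψ` stays injective because it preserves the order. -/
theorem joined_of_eq_map {φ ψ : EmbSpace ℓ S} {h : ℝ → ℝ} (hh : StrictMonoOn h (lineImage φ.1))
    (hψ : ψ.1 = Sum.map id h ∘ φ.1) : Joined φ ψ := by
  have hmono (t : unitInterval) :
      StrictMonoOn (fun x => AffineMap.lineMap x (h x) (t : ℝ)) (lineImage φ.1) :=
    fun x hx y hy hxy => lineMap_strict_mono_endpoints hxy (hh hx hy hxy) t.2.1 t.2.2
  refine ⟨⟨⟨fun t => ⟨_, injective_map_comp φ.2 (hmono t).injOn⟩, ?_⟩, ?_, ?_⟩⟩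
  · refine Continuous.subtype_mk (continuous_pi fun s => ?_) _
    simp only [Function.comp_apply]
    rcases φ.1 s with i | x
    · exact continuous_const
    · exact continuous_inr.comp (by simp only [AffineMap.lineMap_apply_module]; fun_prop)
  · exact Subtype.ext (funext fun s => by rcases hs : φ.1 s <;> simp [hs])
  · exact Subtype.ext (by simp [hψ])

end EmbSpace

/-! ### Relative singular homology in degree zero -/

section PointChain

variable {X Y : TopCat.{0}}

/-- The singular `0`-simplex at a point, as a `0`-chain. -/
def pointChain (x : X) : (singularChains.obj X).X 0 :=
  (TopCat.toSSet.obj X).ιChainComplex (R := AddCommGrpCat.of ℤ) (TopCat.toSSetObj₀Equiv.symm x)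
    (1 : ℤ)

theorem pointChain_hom_ext {B : AddCommGrpCat.{0}} {f g : (singularChains.obj X).X 0 ⟶ B}
    (h : ∀ x, f (pointChain x) = g (pointChain x)) : f = g := by
  refine SSet.chainComplex_hom_ext (X := TopCat.toSSet.obj X) fun x =>
    AddCommGrpCat.int_hom_ext _ _ ?_
  obtain ⟨x, rfl⟩ := TopCat.toSSetObj₀Equiv.symm.surjective x
  exact h x

theorem singularChains_map_pointChain (f : X ⟶ Y) (x : X) :
    (singularChains.map f).f 0 (pointChain x) = pointChain (f x) :=
  ConcreteCategory.congr_hom (SSet.ι_chainComplexMap_f (f := TopCat.toSSet.map f)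
    (R := AddCommGrpCat.of ℤ) (x := TopCat.toSSetObj₀Equiv.symm x)) (1 : ℤ)

theorem fromChainComplexXZero_pointChain (x : X) :
    SSet.π₀.fromChainComplexXZero (TopCat.toSSet.obj X) (AddCommGrpCat.of ℤ) (pointChain x) =
      Sigma.ι (fun _ : (TopCat.toSSet.obj X).π₀ => AddCommGrpCat.of ℤ)
        (TopCat.zerothHomotopyEquiv (.mk x)) (1 : ℤ) :=
  ConcreteCategory.congr_hom (SSet.π₀.comp_fromChainComplexXZero (TopCat.toSSet.obj X)
    (AddCommGrpCat.of ℤ) (TopCat.toSSetObj₀Equiv.symm x)) (1 : ℤ)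

theorem apply_pointChain_eq_of_joined {B : AddCommGrpCat.{0}} {f : (singularChains.obj X).X 0 ⟶ B}
    (hf : (singularChains.obj X).d 1 0 ≫ f = 0) {x y : X} (h : Joined x y) :
    f (pointChain x) = f (pointChain y) := by
  obtain ⟨g, hg⟩ := CokernelCofork.IsColimit.desc'
    (SSet.isColimitCokernelCoforkChainComplexDOneZero (TopCat.toSSet.obj X) (AddCommGrpCat.of ℤ))
    f hf
  have hfg (z : X) : f (pointChain z) =
      g (SSet.π₀.fromChainComplexXZero (TopCat.toSSet.obj X) (AddCommGrpCat.of ℤ) (pointChain z)) :=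
    (ConcreteCategory.congr_hom hg _).symm
  have hxy : ZerothHomotopy.mk x = ZerothHomotopy.mk y := ZerothHomotopy.sound h.somePath
  rw [hfg, hfg, fromChainComplexXZero_pointChain, fromChainComplexXZero_pointChain, hxy]

theorem exists_pointChain_desc {B : Type} [AddCommGroup B] (F : X → B)
    (hF : ∀ x y, Joined x y → F x = F y) :
    ∃ f : (singularChains.obj X).X 0 ⟶ AddCommGrpCat.of B,
      (singularChains.obj X).d 1 0 ≫ f = 0 ∧ ∀ x, f (pointChain x) = F x := by
  let G (c : (TopCat.toSSet.obj X).π₀) : AddCommGrpCat.of ℤ ⟶ AddCommGrpCat.of B :=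
    AddCommGrpCat.ofHom (zmultiplesHom B (ZerothHomotopy.lift F (fun x y γ => hF x y ⟨γ⟩)
      (TopCat.zerothHomotopyEquiv.symm c)))
  refine ⟨SSet.π₀.fromChainComplexXZero (TopCat.toSSet.obj X) _ ≫ Sigma.desc G, ?_, fun x => ?_⟩
  · exact (SSet.π₀.d_fromChainComplexXZero_assoc _ _ _ _).trans zero_comp
  · refine (congrArg (Sigma.desc G) (fromChainComplexXZero_pointChain x)).trans ?_
    refine (ConcreteCategory.congr_hom (Sigma.ι_desc G _) (1 : ℤ)).trans ?_
    simp [G]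

end PointChain

section CokernelHomology

variable {K L K' L' : ChainComplex AddCommGrpCat.{0} ℕ}

/-- The projection from the `0`-chains of `L` to the homology of the cokernel of `φ : K ⟶ L`. -/
def toCokernelHomology (φ : K ⟶ L) : L.X 0 ⟶ (cokernel φ).homology 0 :=
  (cokernel.π φ).f 0 ≫ (cokernel φ).pOpcycles 0 ≫ (ChainComplex.isoHomologyι₀ (cokernel φ)).inv

instance (φ : K ⟶ L) : Epi (toCokernelHomology φ) := by
  have : Epi ((cokernel.π φ).f 0) :=
    inferInstanceAs (Epi ((HomologicalComplex.eval _ _ 0).map (cokernel.π φ)))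
  exact epi_comp' this (epi_comp _ _)

theorem toCokernelHomology_naturality {φ : K ⟶ L} {φ' : K' ⟶ L'} (α : K ⟶ K') (β : L ⟶ L')
    (w : φ ≫ β = α ≫ φ') :
    toCokernelHomology φ ≫ HomologicalComplex.homologyMap (cokernel.map φ φ' α β w) 0 =
      β.f 0 ≫ toCokernelHomology φ' := by
  have hι : (ChainComplex.isoHomologyι₀ (cokernel φ)).inv ≫
      HomologicalComplex.homologyMap (cokernel.map φ φ' α β w) 0 =
        HomologicalComplex.opcyclesMap (cokernel.map φ φ' α β w) 0 ≫
        (ChainComplex.isoHomologyι₀ (cokernel φ')).inv := by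
    rw [Iso.inv_comp_eq, ← Category.assoc, Iso.eq_comp_inv]
    exact HomologicalComplex.homologyι_naturality _ _
  rw [toCokernelHomology, toCokernelHomology, Category.assoc, Category.assoc, hι,
    HomologicalComplex.p_opcyclesMap_assoc, ← HomologicalComplex.comp_f_assoc, cokernel.π_desc,
    HomologicalComplex.comp_f_assoc]

theorem comp_toCokernelHomology (φ : K ⟶ L) : φ.f 0 ≫ toCokernelHomology φ = 0 := by
  rw [toCokernelHomology, ← HomologicalComplex.comp_f_assoc, cokernel.condition,
    HomologicalComplex.zero_f, zero_comp]

theorem d_toCokernelHomology (φ : K ⟶ L) : L.d 1 0 ≫ toCokernelHomology φ = 0 := by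
  rw [toCokernelHomology, ← HomologicalComplex.Hom.comm_assoc,
    HomologicalComplex.d_pOpcycles_assoc, zero_comp, comp_zero]

theorem exists_toCokernelHomology_desc (φ : K ⟶ L) {B : AddCommGrpCat.{0}} (f : L.X 0 ⟶ B)
    (hd : L.d 1 0 ≫ f = 0) (hf : φ.f 0 ≫ f = 0) :
    ∃ g : (cokernel φ).homology 0 ⟶ B, toCokernelHomology φ ≫ g = f := by
  let F : L ⟶ (ChainComplex.single₀ _).obj B := (ChainComplex.toSingle₀Equiv _ _).symm ⟨f, hd⟩
  have hF₀ : F.f 0 = f := ChainComplex.toSingle₀Equiv_symm_apply_f_zero f hd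
  have hF : φ ≫ F = 0 := (ChainComplex.toSingle₀Equiv _ _).injective <| Subtype.ext <|
    (HomologicalComplex.comp_f _ _ _).trans (by rw [hF₀]; exact hf)
  let g : (cokernel φ).X 0 ⟶ B := (ChainComplex.toSingle₀Equiv _ _ (cokernel.desc φ F hF)).1
  have hg : (cokernel.π φ).f 0 ≫ g = f :=
    (congrArg (fun ψ => ψ.f 0) (cokernel.π_desc φ F hF)).trans hF₀
  refine ⟨(ChainComplex.isoHomologyι₀ (cokernel φ)).hom ≫
    (cokernel φ).descOpcycles g 1 (by simp) (ChainComplex.toSingle₀Equiv _ _ _).2, ?_⟩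
  simp only [toCokernelHomology, Category.assoc, Iso.inv_hom_id_assoc,
    HomologicalComplex.p_descOpcycles, hg]

end CokernelHomology

section PointClass

/-- The class of a point in relative homology. -/
def pointClass (p : Arrow TopCat.{0}) (x : p.right) : (relSingularHomology 0).obj p :=
  toCokernelHomology (singularChains.map p.hom) (pointChain x)

variable {p q : Arrow TopCat.{0}}

theorem pointClass_hom_ext {B : Type} [AddCommGroup B] {f g : (relSingularHomology 0).obj p →+ B}
    (h : ∀ x, f (pointClass p x) = g (pointClass p x)) : f = g := by
  have : AddCommGrpCat.ofHom f = AddCommGrpCat.ofHom g :=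
    (cancel_epi (toCokernelHomology (singularChains.map p.hom))).1 (pointChain_hom_ext h)
  exact congrArg AddCommGrpCat.Hom.hom this

theorem pointClass_map (α : p ⟶ q) (x : p.right) :
    (relSingularHomology 0).map α (pointClass p x) = pointClass q (α.right x) := by
  have h := toCokernelHomology_naturality (φ := singularChains.map p.hom)
    (φ' := singularChains.map q.hom) (singularChains.map α.left) (singularChains.map α.right)
    (by rw [← Functor.map_comp, ← Functor.map_comp, Arrow.w])
  exact (ConcreteCategory.congr_hom h (pointChain x)).trans
    (congrArg (toCokernelHomology (singularChains.map q.hom))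
      (singularChains_map_pointChain α.right x))

theorem pointClass_eq_of_joined {x y : p.right} (h : Joined x y) :
    pointClass p x = pointClass p y :=
  apply_pointChain_eq_of_joined (d_toCokernelHomology (singularChains.map p.hom)) h

theorem pointClass_eq_zero (p : Arrow TopCat.{0}) (x : p.left) : pointClass p (p.hom x) = 0 := by
  rw [pointClass, ← singularChains_map_pointChain]
  exact ConcreteCategory.congr_hom (comp_toCokernelHomology (singularChains.map p.hom)) _

theorem exists_pointClass_desc {B : Type} [AddCommGroup B] (F : p.right → B)
    (hF : ∀ x y, Joined x y → F x = F y) (h₀ : ∀ x : p.left, F (p.hom x) = 0) :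
    ∃ g : (relSingularHomology 0).obj p →+ B, ∀ x, g (pointClass p x) = F x := by
  obtain ⟨f, hd, hf⟩ := exists_pointChain_desc F hF
  have hp : (singularChains.map p.hom).f 0 ≫ f = 0 := pointChain_hom_ext fun x => by
    refine (congrArg f (singularChains_map_pointChain p.hom x)).trans ?_
    rw [hf, h₀]
    rfl
  obtain ⟨g, hg⟩ := exists_toCokernelHomology_desc _ f hd hp
  exact ⟨g.hom, fun x => (ConcreteCategory.congr_hom hg (pointChain x)).trans (hf x)⟩

end PointClass

/-! ### The splitting of `ℤ[Emb(-, [ℓ] ⊔ ℝ)] → Ξ(ℓ)` -/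

section Retract

variable {ℓ : ℕ} {S T : FI}

section XiClass

/-- The class in `Ξ(ℓ)_S` of an embedding of `S` into `[ℓ] ⊔ ℝ`. -/
def xiClass (φ : S.carrier ↪ Fin ℓ ⊕ ℝ) : (Xi ℓ).obj (op S) :=
  pointClass ((embPair ℓ).obj (op S)) (⟨φ, φ.injective⟩ : EmbSpace ℓ S)

theorem xi_map_xiClass (f : S ⟶ T) (φ : T.carrier ↪ Fin ℓ ⊕ ℝ) :
    (Xi ℓ).map f.op (xiClass φ) = xiClass (f.trans φ) :=
  pointClass_map ((embPair ℓ).map f.op) _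

theorem xi_hom_ext {B : Type} [AddCommGroup B] {f g : (Xi ℓ).obj (op S) →+ B}
    (h : ∀ φ, f (xiClass φ) = g (xiClass φ)) : f = g :=
  pointClass_hom_ext (p := (embPair ℓ).obj (op S)) fun φ => h φ.toEmb

theorem xiClass_eq_zero {φ : S.carrier ↪ Fin ℓ ⊕ ℝ} {i : Fin ℓ} (h : Sum.inl i ∉ Set.range φ) :
    xiClass φ = 0 :=
  pointClass_eq_zero ((embPair ℓ).obj (op S)) ⟨⟨φ, φ.injective⟩, fun h' => h (h' ⟨i, rfl⟩)⟩

theorem xiClass_eq_of_eq_map {φ ψ : S.carrier ↪ Fin ℓ ⊕ ℝ} {h : ℝ → ℝ}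
    (hh : StrictMonoOn h (lineImage φ)) (hψ : ψ = Sum.map id h ∘ φ) : xiClass ψ = xiClass φ :=
  (pointClass_eq_of_joined (joined_of_eq_map (φ := ⟨φ, φ.injective⟩) (ψ := ⟨ψ, ψ.injective⟩)
    hh hψ)).symm

theorem exists_xiClass_desc {B : Type} [AddCommGroup B] (F : (S.carrier ↪ Fin ℓ ⊕ ℕ) → B)
    (hF : ∀ (τ : S.carrier ↪ Fin ℓ ⊕ ℕ) (i : Fin ℓ), Sum.inl i ∉ Set.range τ → F τ = 0) :
    ∃ g : (Xi ℓ).obj (op S) →+ B, ∀ φ, g (xiClass φ) = F (orderType φ) := by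
  obtain ⟨g, hg⟩ := exists_pointClass_desc (p := (embPair ℓ).obj (op S))
    (fun φ : EmbSpace ℓ S => F (orderType φ.toEmb))
    (fun φ ψ h => congrArg F (orderType_eq_of_joined h)) fun φ => by
      obtain ⟨_, ⟨i, rfl⟩, hi⟩ := Set.not_subset.1 φ.2
      exact hF _ i fun ⟨s, hs⟩ => hi ⟨s, orderType_eq_inl_iff.1 hs⟩
  exact ⟨g, fun φ => hg ⟨φ, φ.injective⟩⟩

variable (ℓ) in
/-- The projection `ℤ[Emb(-, [ℓ] ⊔ ℝ)] → Ξ(ℓ)` that sends an embedding to its class. -/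
def freeEmbToXi : freeEmb (Fin ℓ ⊕ ℝ) ⟶ Xi ℓ where
  app S := AddCommGrpCat.ofHom (freeEmb.lift xiClass)
  naturality T S f := AddCommGrpCat.hom_ext <| freeEmb.hom_ext fun φ => by
    change (freeEmb.lift xiClass) _ = (Xi ℓ).map f (freeEmb.lift xiClass (freeEmb.of φ))
    refine (congrArg _ (freeEmb.map_of f.unop φ)).trans ?_
    rw [freeEmb.lift_of, freeEmb.lift_of]
    exact (xi_map_xiClass f.unop φ).symm

theorem freeEmbToXi_of (φ : S.carrier ↪ Fin ℓ ⊕ ℝ) :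
    (freeEmbToXi ℓ).app (op S) (freeEmb.of φ) = xiClass φ :=
  freeEmb.lift_of _ _

end XiClass

section Displace

/-- The embedding `[ℓ] ⊔ ℕ → [ℓ] ⊔ ℝ` that moves the labels in `D` to distinct points on the
nonpositive half line and sends `ℕ` to the positive half line in the order of the sequence `a`. -/
def displace (D : Finset (Fin ℓ)) (a : ℕ ↪o ℝ) : Fin ℓ ⊕ ℕ ↪ Fin ℓ ⊕ ℝ where
  toFun := Sum.elim (fun i => if i ∈ D then Sum.inr (-(i : ℝ)) else Sum.inl i)
    fun n => Sum.inr (Real.exp (a n))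
  inj' := by
    have hne (i : Fin ℓ) (n : ℕ) : -(i : ℝ) ≠ Real.exp (a n) :=
      ((neg_nonpos.2 (Nat.cast_nonneg _)).trans_lt (Real.exp_pos _)).ne
    refine Function.Injective.sumElim (fun i j h => ?_) (fun m n h => ?_) fun i n => ?_
    · split_ifs at h <;> simpa [Fin.val_inj] using h
    · simpa using h
    · split_ifs <;> simp [hne]

theorem inl_notMem_range_displace {D : Finset (Fin ℓ)} {i : Fin ℓ} (hi : i ∈ D) (a : ℕ ↪o ℝ) :
    Sum.inl i ∉ Set.range (displace D a) := by
  rintro ⟨j | n, h⟩ <;> simp only [displace, Function.Embedding.coeFn_mk, Sum.elim_inl,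
    Sum.elim_inr, reduceCtorEq] at h
  split_ifs at h with hj
  exact hj (Sum.inl_injective h ▸ hi)

theorem displace_empty (a : ℕ ↪o ℝ) :
    (displace ∅ a : Fin ℓ ⊕ ℕ → Fin ℓ ⊕ ℝ) = Sum.map id (Real.exp ∘ a) := by
  funext v
  rcases v with i | n <;> simp [displace]

theorem displace_trans (D : Finset (Fin ℓ)) (σ : ℕ ↪o ℕ) (a : ℕ ↪o ℝ) (v : Fin ℓ ⊕ ℕ) :
    displace D (σ.trans a) v = displace D a (Sum.map id σ v) := by
  rcases v with i | n <;> rfl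

theorem displace_congr {D E : Finset (Fin ℓ)} (a : ℕ ↪o ℝ) {v : Fin ℓ ⊕ ℕ}
    (h : ∀ i, v = Sum.inl i → (i ∈ D ↔ i ∈ E)) : displace D a v = displace E a v := by
  rcases v with i | n
  · simp only [displace, Function.Embedding.coeFn_mk, Sum.elim_inl, h i rfl]
  · rfl

end Displace

section Splitting

/-- The alternating sum over `D ⊆ [ℓ]` of the `D`-displaced embeddings with the order type `τ`,
averaged over the sequences in the formal sum `c n`, where `n` is the number of points of `τ` on
the line. The alternating signs make it vanish if `τ` misses a label. -/
def splitChain (c : ℕ → SeqSum ℝ) (τ : S.carrier ↪ Fin ℓ ⊕ ℕ) :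
    (freeEmb (Fin ℓ ⊕ ℝ)).obj (op S) :=
  ∑ D : Finset (Fin ℓ), (-1 : ℤ) ^ D.card •
    Finsupp.linearCombination ℤ (fun a => freeEmb.of (τ.trans (displace D a)))
      (c (lineImage τ).card)

theorem neg_one_pow_card_symmDiff_singleton {ι : Type*} [DecidableEq ι] (D : Finset ι) (i : ι) :
    (-1 : ℤ) ^ (symmDiff D {i}).card = -(-1) ^ D.card := by
  by_cases hi : i ∈ D
  · have : symmDiff D {i} = D.erase i := by grind [Finset.mem_symmDiff]
    rw [this, ← Finset.card_erase_add_one hi, pow_succ, mul_neg_one, neg_neg]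
  · have : symmDiff D {i} = insert i D := by grind [Finset.mem_symmDiff]
    rw [this, Finset.card_insert_of_notMem hi, pow_succ, mul_neg_one]

theorem splitChain_eq_zero (c : ℕ → SeqSum ℝ) {τ : S.carrier ↪ Fin ℓ ⊕ ℕ} {i : Fin ℓ}
    (hi : Sum.inl i ∉ Set.range τ) : splitChain c τ = 0 := by
  have hdisplace (D : Finset (Fin ℓ)) (a : ℕ ↪o ℝ) :
      τ.trans (displace (symmDiff D {i}) a) = τ.trans (displace D a) := by
    ext s : 1
    refine displace_congr a fun j hj => ?_
    have hji : j ≠ i := fun h => hi ⟨s, h ▸ hj⟩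
    simp [Finset.mem_symmDiff, hji]
  refine Finset.sum_involution (fun D _ => symmDiff D {i}) (fun D _ => ?_) (fun D _ _ h => ?_)
    (fun _ _ => Finset.mem_univ _) fun D _ => symmDiff_symmDiff_cancel_right _ _
  · simp only [hdisplace, neg_one_pow_card_symmDiff_singleton, neg_smul, add_neg_cancel]
  · simp at h

theorem map_linearCombination_int {G H : AddCommGrpCat.{0}} {ι : Type*} (f : G ⟶ H) (v : ι → G)
    (z : ι →₀ ℤ) :
    f (Finsupp.linearCombination ℤ v z) = Finsupp.linearCombination ℤ (fun i => f (v i)) z :=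
  Finsupp.apply_linearCombination ℤ f.hom.toIntLinearMap v z

theorem map_splitChain {c : ℕ → SeqSum ℝ} (hc : IsCoherent c) (f : S ⟶ T)
    (φ : T.carrier ↪ Fin ℓ ⊕ ℝ) :
    (freeEmb (Fin ℓ ⊕ ℝ)).map f.op (splitChain c (orderType φ)) =
      splitChain c (orderType (f.trans φ)) := by
  obtain ⟨σ, hσ, hpull⟩ := hc.exists_pull (lineImage_trans_subset f φ)
  have hdisplace (D : Finset (Fin ℓ)) (a : ℕ ↪o ℝ) :
      (orderType (f.trans φ)).trans (displace D (σ.trans a)) =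
        f.trans ((orderType φ).trans (displace D a)) := by
    ext s : 1
    exact (displace_trans D σ a _).trans (congrArg _ (orderType_trans f φ hσ s).symm)
  simp only [splitChain, map_sum, map_zsmul, map_linearCombination_int, freeEmb.map_of,
    card_lineImage_orderType, ← hpull, linearCombination_pull, hdisplace]

theorem freeEmbToXi_splitChain {c : ℕ → SeqSum ℝ} (hc : IsCoherent c)
    (φ : S.carrier ↪ Fin ℓ ⊕ ℝ) :
    (freeEmbToXi ℓ).app (op S) (splitChain c (orderType φ)) = xiClass φ := by
  have hterm (D : Finset (Fin ℓ)) (hD : D ≠ ∅) (a : ℕ ↪o ℝ) :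
      xiClass ((orderType φ).trans (displace D a)) = 0 := by
    obtain ⟨i, hi⟩ := Finset.nonempty_iff_ne_empty.2 hD
    exact xiClass_eq_zero fun ⟨s, hs⟩ => inl_notMem_range_displace hi a ⟨_, hs⟩
  have hempty (a : ℕ ↪o ℝ) : xiClass ((orderType φ).trans (displace ∅ a)) = xiClass φ := by
    refine xiClass_eq_of_eq_map (h := fun x => Real.exp (a (rank (lineImage φ) x)))
      (fun x hx y _ hxy => Real.exp_lt_exp.2 (a.strictMono (rank_lt_rank hx hxy))) ?_
    rw [Function.Embedding.coe_trans, displace_empty]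
    funext s
    rcases hs : φ s with i | x <;> simp [orderType, hs]
  simp only [splitChain, map_sum, map_zsmul, map_linearCombination_int, freeEmbToXi_of]
  rw [Finset.sum_eq_single ∅ (fun D _ hD => ?_) (by simp)]
  · simp only [hempty, linearCombination_const, hc.mass_eq, one_smul, Finset.card_empty, pow_zero]
  · simp only [hterm D hD, linearCombination_const, smul_zero]

theorem exists_freeEmbToXi_section (ℓ : ℕ) :
    ∃ s : Xi ℓ ⟶ freeEmb (Fin ℓ ⊕ ℝ), s ≫ freeEmbToXi ℓ = 𝟙 (Xi ℓ) := by
  obtain ⟨c, hc⟩ := exists_isCoherent ℝ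
  choose s hs using fun S : FI =>
    exists_xiClass_desc (S := S) (ℓ := ℓ) (splitChain c) fun _ _ => splitChain_eq_zero c
  refine ⟨{ app S := AddCommGrpCat.ofHom (s S.unop), naturality T S f := ?_ }, ?_⟩
  · refine AddCommGrpCat.hom_ext <| xi_hom_ext fun φ => ?_
    change s S.unop ((Xi ℓ).map f (xiClass φ)) =
      (freeEmb (Fin ℓ ⊕ ℝ)).map f (s T.unop (xiClass φ))
    rw [hs]
    exact ((congrArg (s S.unop) (xi_map_xiClass f.unop φ)).trans (hs _ _)).trans
      (map_splitChain hc f.unop φ).symm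
  · ext S : 2
    refine AddCommGrpCat.hom_ext <| xi_hom_ext fun φ => ?_
    exact (congrArg ((freeEmbToXi ℓ).app S) (hs _ φ)).trans (freeEmbToXi_splitChain hc φ)

end Splitting

end Retract

end FI

end

theorem mainTheorem8 (ℓ : ℕ) : FI.IsFlat.{u} (FI.Xi ℓ) := by
  obtain ⟨s, hs⟩ := FI.exists_freeEmbToXi_section ℓ
  exact (FI.isFlat_freeEmb _).of_retract hs
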